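/- Let $\mathcal C$ be a (closed) model category with weak equivalences $\mathcal W$, with finite limits and colimits, and with chosen functorial factorizations of every morphism as a cofibration followed by a trivial fibration and as a trivial cofibration followed by a fibration. A cylinder for $X$ consists of $d_0,d_1:X\to W$ and $s:W\to Z$ with $s\in\mathcal W$ and $sd_0=sd_1$; a homotopy from $f$ to $g$ ($f,g:X\to Y$) is a cylinder for $X$ with an arrow $h:W\to Y$ such that $hd_0=f$, $hd_1=g$. If $F$ is a 2-functor from $\mathcal C$ to a 2-category which sends $\mathcal W$ to equivalences, such a homotopy induces the 2-cell $Fh\cdot\widehat{FC}:Ff\Rightarrow Fg$, where $\widehat{FC}:Fd_0\Rightarrow Fd_1$ is the unique 2-cell with $Fs\cdot\widehat{FC}=\mathrm{id}_{F(sd_0)}$. Let $\mathcal Ho$ be the 2-category whose objects and arrows are the fibrant-cofibrant objects of $\mathcal C$ and the arrows between them, and whose 2-cells are finite sequences of composable homotopies in $\mathcal C$, two sequences being identified when all such $F$ give them the same composite 2-cell; vertical composition is juxtaposition, and whiskering is composition of the homotopies with arrows. Let $\pi_0(\mathcal Ho)$ be the category with the same objects, whose arrows are those of $\mathcal Ho$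 modulo the equivalence relation generated by the existence of a 2-cell, and let $\pi_0:\mathcal Ho\to\pi_0(\mathcal Ho)$ be the projection. Let $q:\mathcal C\to\mathcal Ho$ be the cofibrant replacement functor followed by the fibrant replacement functor (both given by the chosen factorizations, of $0\to X$ and of $X\to 1$) and by the inclusion. Then: 1. $\pi_0q:\mathcal C\to\pi_0(\mathcal Ho)$ is the localization of $\mathcal C$ with respect to $\mathcal W$, up to equivalence: it sends $\mathcal W$ to isomorphisms and, for every category $\mathcal X$, precomposition $(\pi_0q)^*:\mathrm{Hom}(\pi_0(\mathcal Ho),\mathcal X)\to\mathrm{Hom}_+(\mathcal C,\mathcal X)$ is an equivalence of categories, where $\mathrm{Hom}_+(\mathcal C,\mathcal X)$ is the full subcategory of the functors that send $\mathcal W$ to isomorphisms. 2. $\pi_0(\mathcal Ho)$ is equivalent to Quillen's homotopy category $\mathcal C\to\mathcal C[\mathcal W^{-1}]$ (the localization in the strict sense, whose objects are those of $\mathcal C$), by an equivalence compatible, up to natural isomorphism, with the functors from $\mathcal C$. 3. In general they are not isomorphic: there is a model category $\mathcal C$ with functorial factorizations for which $\pi_0(\mathcal Ho)$ and $\mathcal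 C[\mathcal W^{-1}]$ are not isomorphic categories. -/

import Mathlib

open CategoryTheory Bicategory Limits HomotopicalAlgebra

namespace HomotopyTwoCategory

universe w v u v' u' v₁ u₁

section Equivalences

variable {B : Type u} [Bicategory.{w, v} B]

/-- A 1-cell `f : a ⟶ b` of a 2-category is an equivalence if it has a quasi-inverse
`g : b ⟶ a`, i.e. there are invertible 2-cells `𝟙 a ≅ f ≫ g` and `g ≫ f ≅ 𝟙 b`. -/
def IsEquiv {a b : B} (f : a ⟶ b) : Prop :=
  ∃ g : b ⟶ a, Nonempty (𝟙 a ≅ f ≫ g) ∧ Nonempty (g ≫ f ≅ 𝟙 b)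

/-- Postcomposition with an equivalence is fully faithful on hom-categories. -/
theorem IsEquiv.whiskerRight_bijective {a b z : B} {s : a ⟶ b} (hs : IsEquiv s) (f g : z ⟶ a) :
    Function.Bijective (fun α : f ⟶ g => α ▷ s) := by
  obtain ⟨t, ⟨η⟩, ⟨θ⟩⟩ := hs
  let e : (z ⟶ a) ≌ (z ⟶ b) := CategoryTheory.Equivalence.mk (postcomp z s) (postcomp z t)
    (NatIso.ofComponents
      (fun k => (ρ_ k).symm ≪≫ whiskerLeftIso k η ≪≫ (α_ k s t).symm)
      (fun {k l} γ => by
        simp only [postcomp, Functor.id_map, Functor.comp_map, Iso.trans_hom, Iso.symm_hom,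
          whiskerLeftIso_hom, Category.assoc]
        dsimp only [Functor.id_obj, Functor.comp_obj]
        rw [rightUnitor_inv_naturality_assoc, ← whisker_exchange_assoc,
          associator_inv_naturality_left]))
    (NatIso.ofComponents
      (fun k => α_ k t s ≪≫ whiskerLeftIso k θ ≪≫ ρ_ k)
      (fun {k l} γ => by
        simp only [postcomp, Functor.id_map, Functor.comp_map, Iso.trans_hom,
          whiskerLeftIso_hom, Category.assoc]
        dsimp only [Functor.id_obj, Functor.comp_obj]
        rw [associator_naturality_left_assoc, ← whisker_exchange_assoc,
          rightUnitor_naturality]))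
  exact (e.fullyFaithfulFunctor).map_bijective f g

end Equivalences

section Homotopies

variable {C : Type u} [Category.{v} C]

/-- A cylinder for `X` with respect to a class `S` of morphisms: two arrows
`d₀ d₁ : X ⟶ W` together with `s : W ⟶ Z` in `S` and `x : X ⟶ Z` such that
`d₀ ≫ s = x = d₁ ≫ s`. -/
structure Cyl (S : MorphismProperty C) (X : C) where
  W : C
  Z : C
  d₀ : X ⟶ W
  d₁ : X ⟶ W
  s : W ⟶ Z
  x : X ⟶ Z
  hs : S s
  d₀_s : d₀ ≫ s = x
  d₁_s : d₁ ≫ s = x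

/-- A (left) homotopy from `f` to `g`: a cylinder for the source and an arrow `h : W ⟶ Y`
with `d₀ ≫ h = f` and `d₁ ≫ h = g`. -/
structure Hpy (S : MorphismProperty C) {X Y : C} (f g : X ⟶ Y) where
  cyl : Cyl S X
  h : cyl.W ⟶ Y
  d₀_h : cyl.d₀ ≫ h = f
  d₁_h : cyl.d₁ ≫ h = g

/-- Finite sequences of composable homotopies. The class of the empty sequence is the class of
the homotopy with the identity cylinder, when `S` contains the identities. -/
inductive HpySeq (S : MorphismProperty C) {X Y : C} : (X ⟶ Y) → (X ⟶ Y) → Type (max u v)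
  | nil (f : X ⟶ Y) : HpySeq S f f
  | cons {f g l : X ⟶ Y} : HpySeq S f g → Hpy S g l → HpySeq S f l

variable {S : MorphismProperty C}

/-- Precomposition of a cylinder for `X` with `l : X' ⟶ X`. -/
abbrev Cyl.precomp {X' X : C} (l : X' ⟶ X) (c : Cyl S X) : Cyl S X' where
  W := c.W
  Z := c.Z
  d₀ := l ≫ c.d₀
  d₁ := l ≫ c.d₁
  s := c.s
  x := l ≫ c.x
  hs := c.hs
  d₀_s := by rw [Category.assoc, c.d₀_s]
  d₁_s := by rw [Category.assoc, c.d₁_s]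

/-- The homotopy `Hl`. -/
abbrev Hpy.precomp {X' X Y : C} (l : X' ⟶ X) {f g : X ⟶ Y} (H : Hpy S f g) :
    Hpy S (l ≫ f) (l ≫ g) where
  cyl := H.cyl.precomp l
  h := H.h
  d₀_h := by simp only [Cyl.precomp, Category.assoc, H.d₀_h]
  d₁_h := by simp only [Cyl.precomp, Category.assoc, H.d₁_h]

/-- The homotopy `rH`. -/
abbrev Hpy.postcomp {X Y Y' : C} {f g : X ⟶ Y} (H : Hpy S f g) (r : Y ⟶ Y') :
    Hpy S (f ≫ r) (g ≫ r) where
  cyl := H.cyl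
  h := H.h ≫ r
  d₀_h := by rw [← Category.assoc, H.d₀_h]
  d₁_h := by rw [← Category.assoc, H.d₁_h]

namespace HpySeq

/-- Juxtaposition of sequences. -/
def append {X Y : C} {f g : X ⟶ Y} (p : HpySeq S f g) :
    {l : X ⟶ Y} → HpySeq S g l → HpySeq S f l
  | _, nil _ => p
  | _, cons q H => cons (p.append q) H

/-- `[Hₙ, …, H₁] l = [Hₙl, …, H₁l]`. -/
def precomp {X' X Y : C} (l : X' ⟶ X) {f : X ⟶ Y} :
    {g : X ⟶ Y} → HpySeq S f g → HpySeq S (l ≫ f) (l ≫ g)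
  | _, nil _ => nil _
  | _, cons p H => cons (p.precomp l) (H.precomp l)

/-- `r [Hₙ, …, H₁] = [rHₙ, …, rH₁]`. -/
def postcomp {X Y Y' : C} {f : X ⟶ Y} (r : Y ⟶ Y') :
    {g : X ⟶ Y} → HpySeq S f g → HpySeq S (f ≫ r) (g ≫ r)
  | _, nil _ => nil _
  | _, cons p H => cons (p.postcomp r) (H.postcomp r)

end HpySeq

section Cells

/-! A 2-functor from the category `C` (as a discrete 2-category) to a 2-category `D` is
a functor from `C` to the underlying category of `D`. -/

variable {D : Type u'} [Bicategory.{w, v'} D] [Strict D]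

/-- The 2-functor `F : C ⥤ D` sends the class `S` to equivalences. -/
def SendsToEquiv (S : MorphismProperty C) (F : C ⥤ D) : Prop :=
  ∀ ⦃X Y : C⦄ (s : X ⟶ Y), S s → IsEquiv (B := D) (F.map s)

variable {F : C ⥤ D}

theorem Cyl.map_eq (F : C ⥤ D) {X : C} (c : Cyl S X) :
    F.map c.d₀ ≫ F.map c.s = F.map c.d₁ ≫ F.map c.s := by
  rw [← F.map_comp, ← F.map_comp, c.d₀_s, c.d₁_s]

theorem Cyl.existsUnique_cell (hF : SendsToEquiv S F) {X : C} (c : Cyl S X) :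
    ∃! α : F.map c.d₀ ⟶ F.map c.d₁, α ▷ F.map c.s = eqToHom (c.map_eq F) :=
  ((hF c.s c.hs).whiskerRight_bijective _ _).existsUnique _

/-- The unique 2-cell `F d₀ ⟶ F d₁` whose composite with `F s` is the identity of `F x`. -/
noncomputable def Cyl.cell (hF : SendsToEquiv S F) {X : C} (c : Cyl S X) :
    F.map c.d₀ ⟶ F.map c.d₁ :=
  (c.existsUnique_cell hF).choose

theorem Hpy.map_eq₀ (F : C ⥤ D) {X Y : C} {f g : X ⟶ Y} (H : Hpy S f g) :
    F.map f = F.map H.cyl.d₀ ≫ F.map H.h := by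
  rw [← F.map_comp, H.d₀_h]

theorem Hpy.map_eq₁ (F : C ⥤ D) {X Y : C} {f g : X ⟶ Y} (H : Hpy S f g) :
    F.map H.cyl.d₁ ≫ F.map H.h = F.map g := by
  rw [← F.map_comp, H.d₁_h]

/-- The 2-cell `F f ⟶ F g` induced by a homotopy from `f` to `g`: the composite of the
2-cell of the cylinder with `F h`. -/
noncomputable def Hpy.cell (hF : SendsToEquiv S F) {X Y : C} {f g : X ⟶ Y} (H : Hpy S f g) :
    F.map f ⟶ F.map g :=
  eqToHom (H.map_eq₀ F) ≫ H.cyl.cell hF ▷ F.map H.h ≫ eqToHom (H.map_eq₁ F)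

/-- The vertical composite of the 2-cells induced by the homotopies of a sequence. -/
noncomputable def HpySeq.cell (hF : SendsToEquiv S F) {X Y : C} {f : X ⟶ Y} :
    {g : X ⟶ Y} → HpySeq S f g → (F.map f ⟶ F.map g)
  | _, HpySeq.nil _ => 𝟙 _
  | _, HpySeq.cons p H => p.cell hF ≫ H.cell hF

theorem Cyl.cell_spec (hF : SendsToEquiv S F) {X : C} (c : Cyl S X) :
    c.cell hF ▷ F.map c.s = eqToHom (c.map_eq F) :=
  (c.existsUnique_cell hF).choose_spec.1

theorem Cyl.cell_unique (hF : SendsToEquiv S F) {X : C} (c : Cyl S X)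
    (α : F.map c.d₀ ⟶ F.map c.d₁) (hα : α ▷ F.map c.s = eqToHom (c.map_eq F)) :
    α = c.cell hF :=
  (c.existsUnique_cell hF).choose_spec.2 α hα

theorem Cyl.cell_precomp (hF : SendsToEquiv S F) {X' X : C} (l : X' ⟶ X) (c : Cyl S X) :
    (c.precomp l).cell hF =
      eqToHom (F.map_comp l c.d₀) ≫ F.map l ◁ c.cell hF ≫ eqToHom (F.map_comp l c.d₁).symm := by
  refine ((c.precomp l).cell_unique hF _ ?_).symm
  have h := whisker_assoc (F.map l) (c.cell hF) (F.map c.s)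
  simp only [Strict.associator_eqToIso, eqToIso.hom, eqToIso.inv] at h
  change (eqToHom _ ≫ F.map l ◁ c.cell hF ≫ eqToHom _) ▷ F.map c.s = _
  rw [comp_whiskerRight, comp_whiskerRight, h, Cyl.cell_spec]
  simp

theorem Hpy.cell_precomp (hF : SendsToEquiv S F) {X' X Y : C} (l : X' ⟶ X) {f g : X ⟶ Y}
    (H : Hpy S f g) :
    (H.precomp l).cell hF =
      eqToHom (F.map_comp l f) ≫ F.map l ◁ H.cell hF ≫ eqToHom (F.map_comp l g).symm := by
  have h := whisker_assoc (F.map l) (H.cyl.cell hF) (F.map H.h)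
  simp only [Strict.associator_eqToIso, eqToIso.hom, eqToIso.inv] at h
  have e : (H.precomp l).cell hF =
    eqToHom ((H.precomp l).map_eq₀ F) ≫ (H.cyl.precomp l).cell hF ▷ F.map H.h ≫
      eqToHom ((H.precomp l).map_eq₁ F) := rfl
  rw [e, Cyl.cell_precomp, comp_whiskerRight, comp_whiskerRight, h, Hpy.cell]
  simp

theorem Hpy.cell_postcomp (hF : SendsToEquiv S F) {X Y Y' : C} {f g : X ⟶ Y}
    (H : Hpy S f g) (r : Y ⟶ Y') :
    (H.postcomp r).cell hF =
      eqToHom (F.map_comp f r) ≫ H.cell hF ▷ F.map r ≫ eqToHom (F.map_comp g r).symm := by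
  have h := whiskerRight_comp (H.cyl.cell hF) (F.map H.h) (F.map r)
  have h' := whiskerRight_congr (F.map_comp H.h r) (H.cyl.cell hF)
  simp only [Strict.associator_eqToIso, eqToIso.hom, eqToIso.inv] at h
  have e : (H.postcomp r).cell hF =
    eqToHom ((H.postcomp r).map_eq₀ F) ≫ H.cyl.cell hF ▷ F.map (H.h ≫ r) ≫
      eqToHom ((H.postcomp r).map_eq₁ F) := rfl
  rw [e, h', h, Hpy.cell]
  simp

theorem HpySeq.cell_append (hF : SendsToEquiv S F) {X Y : C} {f g l : X ⟶ Y}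
    (p : HpySeq S f g) (q : HpySeq S g l) :
    (p.append q).cell hF = p.cell hF ≫ q.cell hF := by
  induction q with
  | nil => simp [append, cell]
  | cons q H ih => simp [append, cell, ih]

theorem HpySeq.cell_precomp (hF : SendsToEquiv S F) {X' X Y : C} (l : X' ⟶ X) {f g : X ⟶ Y}
    (p : HpySeq S f g) :
    (p.precomp l).cell hF =
      eqToHom (F.map_comp l f) ≫ F.map l ◁ p.cell hF ≫ eqToHom (F.map_comp l g).symm := by
  induction p with
  | nil => simp [precomp, cell]
  | cons p H ih => simp [precomp, cell, ih, Hpy.cell_precomp]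

theorem HpySeq.cell_postcomp (hF : SendsToEquiv S F) {X Y Y' : C} {f g : X ⟶ Y}
    (p : HpySeq S f g) (r : Y ⟶ Y') :
    (p.postcomp r).cell hF =
      eqToHom (F.map_comp f r) ≫ p.cell hF ▷ F.map r ≫ eqToHom (F.map_comp g r).symm := by
  induction p with
  | nil => simp [postcomp, cell]
  | cons p H ih => simp [postcomp, cell, ih, Hpy.cell_postcomp]

end Cells

/-- Two sequences of homotopies are identified when every 2-functor to a 2-category which
sends `S` to equivalences gives them the same 2-cell. (A 2-functor on `C` only sees a
sub-2-category with at most as many cells as `C`, so that one universe of 2-categories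
suffices.) -/
def hpySetoid (S : MorphismProperty C) {X Y : C} (f g : X ⟶ Y) : Setoid (HpySeq S f g) where
  r p q := ∀ (D : Type (max u v)) [Bicategory.{max u v, max u v} D] [Strict D]
    (F : C ⥤ D) (hF : SendsToEquiv S F), p.cell hF = q.cell hF
  iseqv :=
    { refl := fun _ _ _ _ _ _ => rfl
      symm := fun h D _ _ F hF => (h D F hF).symm
      trans := fun h h' D _ _ F hF => (h D F hF).trans (h' D F hF) }

end Homotopies

section TwoCategory

variable {C : Type u} [Category.{v} C]

/-- The homotopy 2-category of `C` with respect to `S`: objects and 1-cells are those of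
`C`, and 2-cells are the classes of finite sequences of composable homotopies. -/
structure HCat (S : MorphismProperty C) where
  as : C

namespace HCat

variable {S : MorphismProperty C}

instance : CategoryStruct (HCat S) where
  Hom X Y := X.as ⟶ Y.as
  id X := 𝟙 X.as
  comp f g := CategoryStruct.comp (obj := C) f g

/-- The 1-cell of `HCat S` given by an arrow of `C`. -/
abbrev ofHom {X Y : C} (f : X ⟶ Y) : (HCat.mk (S := S) X) ⟶ HCat.mk Y := f

/-- The arrow of `C` underlying a 1-cell of `HCat S`. -/
abbrev toHom {X Y : HCat S} (f : X ⟶ Y) : X.as ⟶ Y.as := f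

/-- Vertical composition is juxtaposition of sequences. -/
instance (X Y : HCat S) : Category (X ⟶ Y) where
  Hom f g := Quotient (hpySetoid S (toHom f) (toHom g))
  id f := Quotient.mk _ (HpySeq.nil (toHom f))
  comp := Quotient.map₂ (fun p q => p.append q) (fun p p' hp q q' hq D _ _ F hF => by
    rw [HpySeq.cell_append, HpySeq.cell_append, hp D F hF, hq D F hF])
  id_comp := by
    rintro f g ⟨p⟩
    refine Quotient.sound (fun D _ _ F hF => ?_)
    rw [HpySeq.cell_append]
    exact Category.id_comp _
  comp_id := by
    rintro f g ⟨p⟩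
    refine Quotient.sound (fun D _ _ F hF => ?_)
    rw [HpySeq.cell_append]
    exact Category.comp_id _
  assoc := by
    rintro f g k l ⟨p⟩ ⟨q⟩ ⟨r⟩
    refine Quotient.sound (fun D _ _ F hF => ?_)
    simp only [HpySeq.cell_append, Category.assoc]

section Cells

variable {D : Type (max u v)} [Bicategory.{max u v, max u v} D] [Strict D] {F : C ⥤ D}

/-- The 2-cell of `D` induced by a 2-cell of `HCat S`. -/
noncomputable def cell (hF : SendsToEquiv S F) {X Y : HCat S} {f g : X ⟶ Y} (α : f ⟶ g) :
    F.map (toHom f) ⟶ F.map (toHom g) :=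
  Quotient.lift (fun p : HpySeq S (toHom f) (toHom g) => p.cell hF)
    (fun p q (h : (hpySetoid S (toHom f) (toHom g)).r p q) => h D F hF) α

theorem cell_id (hF : SendsToEquiv S F) {X Y : HCat S} (f : X ⟶ Y) :
    cell hF (𝟙 f) = 𝟙 _ := rfl

theorem cell_comp (hF : SendsToEquiv S F) {X Y : HCat S} {f g l : X ⟶ Y} (α : f ⟶ g)
    (β : g ⟶ l) : cell hF (α ≫ β) = cell hF α ≫ cell hF β := by
  obtain ⟨α⟩ := α
  obtain ⟨β⟩ := β
  exact HpySeq.cell_append hF _ _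

theorem cell_eqToHom (hF : SendsToEquiv S F) {X Y : HCat S} {f g : X ⟶ Y} (h : f = g) :
    cell hF (eqToHom h) = eqToHom (congrArg (fun k : X ⟶ Y => F.map (toHom k)) h) := by
  subst h
  rfl

end Cells

theorem hom₂_ext {X Y : HCat S} {f g : X ⟶ Y} {α β : f ⟶ g}
    (h : ∀ (D : Type (max u v)) [Bicategory.{max u v, max u v} D] [Strict D]
      (F : C ⥤ D) (hF : SendsToEquiv S F), cell hF α = cell hF β) : α = β := by
  obtain ⟨α⟩ := α
  obtain ⟨β⟩ := β
  exact Quotient.sound (fun D _ _ F hF => h D F hF)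

/-- `[H] * l = [Hl]`. -/
def whiskerL {X' X Y : HCat S} (l : X' ⟶ X) {f g : X ⟶ Y} (α : f ⟶ g) : l ≫ f ⟶ l ≫ g :=
  Quotient.map (sa := hpySetoid S (toHom f) (toHom g))
    (sb := hpySetoid S (toHom (l ≫ f)) (toHom (l ≫ g)))
    (fun p => p.precomp (toHom l)) (fun p q h D _ _ F hF => by
    rw [HpySeq.cell_precomp, HpySeq.cell_precomp, h D F hF]) α

/-- `r * [H] = [rH]`. -/
def whiskerR {X Y Y' : HCat S} {f g : X ⟶ Y} (α : f ⟶ g) (r : Y ⟶ Y') : f ≫ r ⟶ g ≫ r :=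
  Quotient.map (sa := hpySetoid S (toHom f) (toHom g))
    (sb := hpySetoid S (toHom (f ≫ r)) (toHom (g ≫ r)))
    (fun p => p.postcomp (toHom r)) (fun p q h D _ _ F hF => by
    rw [HpySeq.cell_postcomp, HpySeq.cell_postcomp, h D F hF]) α

section Cells

variable {D : Type (max u v)} [Bicategory.{max u v, max u v} D] [Strict D] {F : C ⥤ D}

theorem cell_whiskerL (hF : SendsToEquiv S F) {X' X Y : HCat S} (l : X' ⟶ X) {f g : X ⟶ Y}
    (α : f ⟶ g) : cell hF (whiskerL l α) =
      eqToHom (F.map_comp (toHom l) (toHom f)) ≫ F.map (toHom l) ◁ cell hF α ≫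
        eqToHom (F.map_comp (toHom l) (toHom g)).symm := by
  obtain ⟨α⟩ := α
  exact HpySeq.cell_precomp hF _ _

theorem cell_whiskerR (hF : SendsToEquiv S F) {X Y Y' : HCat S} {f g : X ⟶ Y}
    (α : f ⟶ g) (r : Y ⟶ Y') : cell hF (whiskerR α r) =
      eqToHom (F.map_comp (toHom f) (toHom r)) ≫ cell hF α ▷ F.map (toHom r) ≫
        eqToHom (F.map_comp (toHom g) (toHom r)).symm := by
  obtain ⟨α⟩ := α
  exact HpySeq.cell_postcomp hF _ _

end Cells

theorem id_comp' {X Y : HCat S} (f : X ⟶ Y) : 𝟙 X ≫ f = f := Category.id_comp (toHom f)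

theorem comp_id' {X Y : HCat S} (f : X ⟶ Y) : f ≫ 𝟙 Y = f := Category.comp_id (toHom f)

theorem assoc' {X Y Z T : HCat S} (f : X ⟶ Y) (g : Y ⟶ Z) (h : Z ⟶ T) :
    (f ≫ g) ≫ h = f ≫ g ≫ h := Category.assoc (toHom f) (toHom g) (toHom h)

instance : Bicategory (HCat S) where
  whiskerLeft l _ _ α := whiskerL l α
  whiskerRight α r := whiskerR α r
  associator f g h := eqToIso (assoc' f g h)
  leftUnitor f := eqToIso (id_comp' f)
  rightUnitor f := eqToIso (comp_id' f)
  whiskerLeft_id _ _ := by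
    refine hom₂_ext (fun D _ _ F hF => ?_)
    simp [cell_id, cell_whiskerL]
    rfl
  whiskerLeft_comp := by
    intros
    refine hom₂_ext (fun D _ _ F hF => ?_)
    simp [cell_comp, cell_whiskerL]
  id_whiskerLeft {a b f g} η := by
    refine hom₂_ext (fun D _ _ F hF => ?_)
    have h : F.map (toHom (𝟙 a)) = 𝟙 _ := F.map_id _
    simp [cell_comp, cell_whiskerL, cell_eqToHom, congr_whiskerLeft h,
      Strict.leftUnitor_eqToIso]
  comp_whiskerLeft f g _ _ η := by
    refine hom₂_ext (fun D _ _ F hF => ?_)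
    have h : F.map (toHom (f ≫ g)) = F.map (toHom f) ≫ F.map (toHom g) := F.map_comp _ _
    simp [cell_comp, cell_whiskerL, cell_eqToHom, congr_whiskerLeft h,
      Strict.associator_eqToIso]
  id_whiskerRight _ _ := by
    refine hom₂_ext (fun D _ _ F hF => ?_)
    simp [cell_id, cell_whiskerR]
    rfl
  comp_whiskerRight := by
    intros
    refine hom₂_ext (fun D _ _ F hF => ?_)
    simp [cell_comp, cell_whiskerR]
  whiskerRight_id {a b f g} η := by
    refine hom₂_ext (fun D _ _ F hF => ?_)
    have h : F.map (toHom (𝟙 b)) = 𝟙 _ := F.map_id _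
    simp [cell_comp, cell_whiskerR, cell_eqToHom, whiskerRight_congr h,
      Strict.rightUnitor_eqToIso]
  whiskerRight_comp η g h := by
    refine hom₂_ext (fun D _ _ F hF => ?_)
    have h' : F.map (toHom (g ≫ h)) = F.map (toHom g) ≫ F.map (toHom h) := F.map_comp _ _
    simp [cell_comp, cell_whiskerR, cell_eqToHom, whiskerRight_congr h',
      Strict.associator_eqToIso]
  whisker_assoc := by
    intros
    refine hom₂_ext (fun D _ _ F hF => ?_)
    simp [cell_comp, cell_whiskerL, cell_whiskerR, cell_eqToHom, Strict.associator_eqToIso]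
  whisker_exchange := by
    intros
    refine hom₂_ext (fun D _ _ F hF => ?_)
    simp [cell_comp, cell_whiskerL, cell_whiskerR, whisker_exchange_assoc]
  pentagon := by
    intros
    refine hom₂_ext (fun D _ _ F hF => ?_)
    simp [cell_comp, cell_whiskerL, cell_whiskerR, cell_eqToHom]
  triangle := by
    intros
    refine hom₂_ext (fun D _ _ F hF => ?_)
    simp [cell_comp, cell_whiskerL, cell_whiskerR, cell_eqToHom]

instance : Strict (HCat S) where
  id_comp := id_comp'
  comp_id := comp_id'
  assoc := assoc'
  leftUnitor_eqToIso _ := rfl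
  rightUnitor_eqToIso _ := rfl
  associator_eqToIso _ _ _ := rfl

end HCat

end TwoCategory

section ConnectedComponents

/-- `π₀` of a 2-category `B`: the category with the objects of `B`, whose arrows are the
1-cells of `B` up to the equivalence relation generated by the existence of a 2-cell. -/
structure PiZero (B : Type u) where
  as : B

instance (B : Type u) [Bicategory.{w, v} B] : Category (PiZero B) where
  Hom X Y := ConnectedComponents (X.as ⟶ Y.as)
  id X := Quotient.mk (Zigzag.setoid _) (𝟙 X.as)
  comp := Quotient.map₂ (fun f g => f ≫ g) (fun f f' hf g g' hg =>
    (zigzag_obj_of_zigzag (postcomp _ g) hf).trans (zigzag_obj_of_zigzag (precomp _ f') hg))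
  id_comp := by
    rintro X Y ⟨f⟩
    exact Quotient.sound (Zigzag.of_hom (λ_ f).hom)
  comp_id := by
    rintro X Y ⟨f⟩
    exact Quotient.sound (Zigzag.of_hom (ρ_ f).hom)
  assoc := by
    rintro X Y Z T ⟨f⟩ ⟨g⟩ ⟨h⟩
    exact Quotient.sound (Zigzag.of_hom (α_ f g h).hom)

/-- The projection of a 2-category onto its `π₀` (on underlying categories; it sends every
2-cell to an identity): the identity on objects, and `f ↦ [f]` on 1-cells. -/
def toPiZero (B : Type u) [Bicategory.{w, v} B] [Strict B] : B ⥤ PiZero B where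
  obj X := ⟨X⟩
  map f := Quotient.mk (Zigzag.setoid _) f
  map_id _ := rfl
  map_comp _ _ := rfl

end ConnectedComponents

section ModelCategories

variable (C : Type u) [Category.{v} C] [ModelCategory C]

/-- The full sub-2-category of the homotopy 2-category of `C` with respect to the weak
equivalences on the fibrant-cofibrant objects. The cylinders are taken in `C`. -/
abbrev Ho := InducedBicategory (HCat (weakEquivalences C))
  (fun X : BifibrantObject C => (HCat.mk X.obj : HCat (weakEquivalences C)))

/-- The inclusion of the fibrant-cofibrant objects into `Ho C`. -/
def incl : BifibrantObject C ⥤ Ho C where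
  obj X := X
  map f := InducedBicategory.mkHom (HCat.ofHom f.hom)
  map_id _ := rfl
  map_comp _ _ := rfl

variable {C}

/-- The functor `X ↦ (0 ⟶ X)`, `f ↦ (id₀, f)`. -/
noncomputable def initialArrow : C ⥤ Arrow C where
  obj X := Arrow.mk (initial.to X)
  map {X Y} f := Arrow.homMk (f := Arrow.mk (initial.to X)) (g := Arrow.mk (initial.to Y)) (𝟙 _) f
    (Subsingleton.elim (α := (⊥_ C) ⟶ Y) _ _)
  map_id _ := rfl
  map_comp f g := by
    ext
    · exact (Category.id_comp _).symm
    · rfl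

/-- The functor `X ↦ (X ⟶ 1)`, `f ↦ (f, id₁)`. -/
noncomputable def terminalArrow : C ⥤ Arrow C where
  obj X := Arrow.mk (terminal.from X)
  map {X Y} f := Arrow.homMk (f := Arrow.mk (terminal.from X)) (g := Arrow.mk (terminal.from Y))
    f (𝟙 _) (Subsingleton.elim (α := X ⟶ ⊤_ C) _ _)
  map_id _ := rfl
  map_comp f g := by
    ext
    · rfl
    · exact (Category.id_comp _).symm

/-- Cofibrant replacement: `Q X` is the middle object of the chosen functorial factorization
of `0 ⟶ X` as a cofibration followed by a trivial fibration, and `Q f = F(id₀, f)`. -/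
noncomputable def cofibrantReplacement
    (Φ : MorphismProperty.FunctorialFactorizationData (cofibrations C) (trivialFibrations C)) :
    C ⥤ CofibrantObject C :=
  ObjectProperty.lift _ (initialArrow ⋙ Φ.Z) (fun X => by
    have h := Φ.hi (initialArrow.obj X)
    rw [← cofibration_iff] at h
    have e : Φ.i.app (initialArrow.obj X) = initial.to (Φ.Z.obj (initialArrow.obj X)) :=
      Subsingleton.elim (α := (⊥_ C) ⟶ Φ.Z.obj (initialArrow.obj X)) _ _
    change Cofibration (initial.to (Φ.Z.obj (initialArrow.obj X)))
    rw [← e]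
    exact h)

/-- Fibrant replacement of cofibrant objects: `R X` is the middle object of the chosen
functorial factorization of `X ⟶ 1` as a trivial cofibration followed by a fibration, and
`R f = F(f, id₁)`. -/
noncomputable def fibrantReplacement
    (Ψ : MorphismProperty.FunctorialFactorizationData (trivialCofibrations C) (fibrations C)) :
    CofibrantObject C ⥤ BifibrantObject C :=
  ObjectProperty.lift _ (CofibrantObject.ι ⋙ terminalArrow ⋙ Ψ.Z) (fun X => by
    constructor
    · have h := (Ψ.hi (terminalArrow.obj X.obj)).1
      rw [← cofibration_iff] at h
      let f : X.obj ⟶ Ψ.Z.obj (terminalArrow.obj X.obj) := Ψ.i.app (terminalArrow.obj X.obj)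
      have : Cofibration f := h
      exact isCofibrant_of_cofibration f
    · have h := Ψ.hp (terminalArrow.obj X.obj)
      rw [← fibration_iff] at h
      have e : Ψ.p.app (terminalArrow.obj X.obj) =
          terminal.from (Ψ.Z.obj (terminalArrow.obj X.obj)) :=
        Subsingleton.elim (α := Ψ.Z.obj (terminalArrow.obj X.obj) ⟶ ⊤_ C) _ _
      change Fibration (terminal.from (Ψ.Z.obj (terminalArrow.obj X.obj)))
      rw [← e]
      exact h)

/-- `q : C ⟶ Ho C`: cofibrant replacement, then fibrant replacement, then the inclusion. -/
noncomputable def toHo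
    (Φ : MorphismProperty.FunctorialFactorizationData (cofibrations C) (trivialFibrations C))
    (Ψ : MorphismProperty.FunctorialFactorizationData (trivialCofibrations C) (fibrations C)) :
    C ⥤ Ho C :=
  cofibrantReplacement Φ ⋙ fibrantReplacement Ψ ⋙ incl C

end ModelCategories

/-- Precomposition `Hom(D, E) ⥤ Hom₊(C, E)` with a functor `L : C ⥤ D` inverting `W`, where
`Hom₊(C, E)` is the full subcategory of the functors sending `W` to isomorphisms. -/
def precompInverting {C : Type u} [Category.{v} C] {D : Type u₁} [Category.{v₁} D]
    (W : MorphismProperty C) (L : C ⥤ D) (hL : W.IsInvertedBy L)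
    (E : Type u') [Category.{v'} E] : (D ⥤ E) ⥤ W.FunctorsInverting E :=
  ObjectProperty.lift _ ((Functor.whiskeringLeft C D E).obj L)
    (fun G => MorphismProperty.IsInvertedBy.of_comp W L hL G)

end HomotopyTwoCategory

open HomotopyTwoCategory

universe u v u' v'

namespace HomotopyTwoCategory

section PiZeroHo

variable {C : Type u} [Category.{v} C]

/-- A homotopy identifies its ends after inverting the class `S`. -/
theorem Hpy.map_eq_of_isInvertedBy {S : MorphismProperty C} {D : Type*} [Category* D]
    {L : C ⥤ D} (hL : S.IsInvertedBy L) {X Y : C} {f g : X ⟶ Y} (H : Hpy S f g) :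
    L.map f = L.map g := by
  have := hL H.cyl.s H.cyl.hs
  have h : L.map H.cyl.d₀ = L.map H.cyl.d₁ := by
    rw [← cancel_mono (L.map H.cyl.s), ← L.map_comp, ← L.map_comp, H.cyl.d₀_s, H.cyl.d₁_s]
  calc
    L.map f = L.map H.cyl.d₀ ≫ L.map H.h := by rw [← L.map_comp, H.d₀_h]
    _ = L.map g := by rw [h, ← L.map_comp, H.d₁_h]

theorem HpySeq.map_eq_of_isInvertedBy {S : MorphismProperty C} {D : Type*} [Category* D]
    {L : C ⥤ D} (hL : S.IsInvertedBy L) {X Y : C} {f g : X ⟶ Y} (p : HpySeq S f g) :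
    L.map f = L.map g := by
  induction p with
  | nil => rfl
  | cons p H ih => exact ih.trans (H.map_eq_of_isInvertedBy hL)

/-- The homotopy given by a left homotopy with respect to a cylinder object. -/
def hpyOfLeftHomotopy [CategoryWithWeakEquivalences C] {X Y : C} {P : Cylinder X} {f g : X ⟶ Y}
    (h : P.LeftHomotopy f g) : Hpy (weakEquivalences C) f g where
  cyl :=
    { W := P.I
      Z := X
      d₀ := P.i₀
      d₁ := P.i₁
      s := P.π
      x := 𝟙 X
      hs := (weakEquivalence_iff _).1 inferInstance
      d₀_s := P.i₀_π
      d₁_s := P.i₁_π }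
  h := h.h
  d₀_h := h.h₀
  d₁_h := h.h₁

variable [ModelCategory C]

/-- The functor from the bifibrant objects to `π₀ (Ho C)`. -/
abbrev bifibrantToPiZero : BifibrantObject C ⥤ PiZero (Ho C) :=
  incl C ⋙ toPiZero (Ho C)

theorem bifibrantToPiZero_map_eq_iff {X Y : BifibrantObject C} (f g : X ⟶ Y) :
    bifibrantToPiZero.map f = bifibrantToPiZero.map g ↔ BifibrantObject.homRel C f g := by
  rw [BifibrantObject.homRel_iff_leftHomotopyRel]
  constructor
  · intro h
    rw [LeftHomotopyRel.iff_map_eq (weakEquivalences C).Q]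
    have hz : Zigzag ((incl C).map f) ((incl C).map g) := Quotient.exact h
    have hom {k l : (incl C).obj X ⟶ (incl C).obj Y} (η : k ⟶ l) :
        (weakEquivalences C).Q.map (HCat.toHom k.hom) =
          (weakEquivalences C).Q.map (HCat.toHom l.hom) := by
      obtain ⟨⟨p⟩⟩ := η
      exact p.map_eq_of_isInvertedBy (Localization.inverts _ _)
    refine hz.rec (motive := fun l _ => (weakEquivalences C).Q.map f.hom =
      (weakEquivalences C).Q.map (HCat.toHom l.hom)) rfl (fun _ hkl ih => ih.trans ?_)
    obtain ⟨⟨η⟩⟩ | ⟨⟨η⟩⟩ := hkl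
    · exact hom η
    · exact (hom η).symm
  · rintro ⟨P, ⟨h⟩⟩
    exact Quotient.sound (Zigzag.of_hom (InducedBicategory.mkHom₂
      (Quotient.mk _ (HpySeq.cons (HpySeq.nil f.hom) (hpyOfLeftHomotopy h)))))

/-- The comparison functor from the category of bifibrant objects up to homotopy. -/
def hoCatToPiZero : BifibrantObject.HoCat C ⥤ PiZero (Ho C) :=
  CategoryTheory.Quotient.lift _ bifibrantToPiZero
    (fun _ _ _ _ h => (bifibrantToPiZero_map_eq_iff _ _).2 h)

instance : (hoCatToPiZero (C := C)).Faithful where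
  map_injective {X Y f g} h := by
    obtain ⟨f, rfl⟩ := BifibrantObject.toHoCat.map_surjective f
    obtain ⟨g, rfl⟩ := BifibrantObject.toHoCat.map_surjective g
    exact BifibrantObject.toHoCat_map_eq ((bifibrantToPiZero_map_eq_iff f g).1 h)

instance : (hoCatToPiZero (C := C)).Full where
  map_surjective {X Y} := by
    rintro ⟨f⟩
    exact ⟨BifibrantObject.toHoCat.map (ObjectProperty.homMk f.hom), rfl⟩

instance : (hoCatToPiZero (C := C)).EssSurj where
  mem_essImage X := ⟨BifibrantObject.toHoCat.obj X.as, ⟨Iso.refl _⟩⟩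

instance : (hoCatToPiZero (C := C)).IsEquivalence where

instance bifibrantToPiZero_isLocalization :
    (bifibrantToPiZero (C := C)).IsLocalization (weakEquivalences (BifibrantObject C)) :=
  Functor.IsLocalization.of_equivalence_target BifibrantObject.toHoCat _ _
    hoCatToPiZero.asEquivalence (Iso.refl _)

variable (Φ : MorphismProperty.FunctorialFactorizationData (cofibrations C) (trivialFibrations C))
  (Ψ : MorphismProperty.FunctorialFactorizationData (trivialCofibrations C) (fibrations C))

/-- The trivial fibration from the cofibrant replacement. -/
noncomputable def cofibrantReplacementπ : cofibrantReplacement Φ ⋙ CofibrantObject.ι ⟶ 𝟭 C :=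
  Functor.whiskerLeft initialArrow Φ.p

/-- The trivial cofibration to the fibrant replacement of a cofibrant object. -/
noncomputable def fibrantReplacementι :
    CofibrantObject.ι ⟶ fibrantReplacement Ψ ⋙ BifibrantObject.ι :=
  Functor.whiskerLeft (CofibrantObject.ι ⋙ terminalArrow) Ψ.i

theorem weakEquivalences_cofibrantReplacementπ (X : C) :
    weakEquivalences C ((cofibrantReplacementπ Φ).app X) :=
  (Φ.hp (initialArrow.obj X)).2

theorem weakEquivalences_fibrantReplacementι (X : CofibrantObject C) :
    weakEquivalences C ((fibrantReplacementι Ψ).app X) :=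
  (Ψ.hi (terminalArrow.obj X.obj)).2

/-- The bifibrant replacement becomes isomorphic to the identity after inverting the weak
equivalences. -/
theorem nonempty_bifibrantReplacement_iso {D : Type*} [Category* D] (L : C ⥤ D)
    (hL : (weakEquivalences C).IsInvertedBy L) :
    Nonempty ((cofibrantReplacement Φ ⋙ fibrantReplacement Ψ) ⋙ BifibrantObject.ι ⋙ L ≅ L) := by
  let α : (cofibrantReplacement Φ ⋙ CofibrantObject.ι) ⋙ L ⟶ 𝟭 C ⋙ L :=
    Functor.whiskerRight (cofibrantReplacementπ Φ) L
  let β : cofibrantReplacement Φ ⋙ CofibrantObject.ι ⋙ L ⟶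
      cofibrantReplacement Φ ⋙ (fibrantReplacement Ψ ⋙ BifibrantObject.ι) ⋙ L :=
    Functor.whiskerLeft _ (Functor.whiskerRight (fibrantReplacementι Ψ) L)
  have (X : C) : IsIso (α.app X) := hL _ (weakEquivalences_cofibrantReplacementπ Φ X)
  have (X : C) : IsIso (β.app X) := hL _ (weakEquivalences_fibrantReplacementι Ψ _)
  have := NatIso.isIso_of_isIso_app α
  have := NatIso.isIso_of_isIso_app β
  exact ⟨(asIso β).symm ≪≫ asIso α⟩

theorem toHo_toPiZero_isLocalization :
    (toHo Φ Ψ ⋙ toPiZero (Ho C)).IsLocalization (weakEquivalences C) := by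
  let L := (weakEquivalences C).Q
  let E := Localization.uniq (BifibrantObject.ι ⋙ L) bifibrantToPiZero
    (weakEquivalences (BifibrantObject C))
  let e : (BifibrantObject.ι ⋙ L) ⋙ E.functor ≅ bifibrantToPiZero :=
    Localization.compUniqFunctor _ _ (weakEquivalences (BifibrantObject C))
  obtain ⟨i⟩ := nonempty_bifibrantReplacement_iso Φ Ψ L (Localization.inverts L _)
  exact Functor.IsLocalization.of_equivalence_target L _ _ E
    (Functor.isoWhiskerRight i.symm E.functor ≪≫
      Functor.isoWhiskerLeft (cofibrantReplacement Φ ⋙ fibrantReplacement Ψ) e)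

end PiZeroHo

section WalkingArrow

/-- The category `0 ⟶ 1`, in arbitrary universes. -/
structure WalkingArrow : Type u where
  val : Bool

instance : Category.{v} WalkingArrow.{u} where
  Hom X Y := ULift (PLift (X.val ≤ Y.val))
  id X := ⟨⟨le_refl X.val⟩⟩
  comp f g := ⟨⟨le_trans f.down.down g.down.down⟩⟩

namespace WalkingArrow

instance (X Y : WalkingArrow.{u}) : Subsingleton (X ⟶ Y) :=
  inferInstanceAs (Subsingleton (ULift (PLift (X.val ≤ Y.val))))

theorem eq_of_isIso {X Y : WalkingArrow.{u}} (f : X ⟶ Y) [IsIso f] : X = Y := by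
  obtain ⟨x⟩ := X
  obtain ⟨y⟩ := Y
  exact congrArg _ (le_antisymm f.down.down (inv f).down.down)

/-- The functor to the order `Bool`. -/
def toBool : WalkingArrow.{u} ⥤ Bool where
  obj X := X.val
  map f := homOfLE f.down.down

instance : toBool.{u, v}.Faithful where

instance : toBool.{u, v}.Full where
  map_surjective f := ⟨⟨⟨leOfHom f⟩⟩, Subsingleton.elim _ _⟩

instance : toBool.{u, v}.EssSurj where
  mem_essImage b := ⟨⟨b⟩, ⟨Iso.refl _⟩⟩

instance : toBool.{u, v}.IsEquivalence where

instance : HasFiniteLimits.{v} WalkingArrow.{u} where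
  out _ _ _ := Adjunction.hasLimitsOfShape_of_equivalence toBool.{u, v}

instance : HasFiniteColimits.{v} WalkingArrow.{u} where
  out _ _ _ := Adjunction.hasColimitsOfShape_of_equivalence toBool.{u, v}

end WalkingArrow

end WalkingArrow

section Contractible

variable (C : Type u) [Category.{v} C]

/-- The factorization of `f` as `f` followed by an identity. -/
def trivialFunctorialFactorizationData :
    MorphismProperty.FunctorialFactorizationData (⊤ : MorphismProperty C)
      (MorphismProperty.isomorphisms C) where
  Z := Arrow.rightFunc
  i := Arrow.leftToRight
  p := 𝟙 _
  hi _ := trivial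
  hp _ := by
    rw [NatTrans.id_app]
    exact MorphismProperty.id_mem _ _

instance : (⊤ : MorphismProperty C).IsWeakFactorizationSystem
    (MorphismProperty.isomorphisms C) :=
  have : (⊤ : MorphismProperty C).HasFactorization (MorphismProperty.isomorphisms C) :=
    ⟨fun f => ⟨(trivialFunctorialFactorizationData C).factorizationData f⟩⟩
  have : (⊤ : MorphismProperty C).IsStableUnderRetracts := ⟨fun _ _ => trivial⟩
  .mk' _ _ (fun i p _ hp => by
    have : IsIso p := hp
    infer_instance)

/-- The model structure in which all the morphisms are weak equivalences and cofibrations, and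
the fibrations are the isomorphisms. -/
@[reducible]
def contractibleModelCategory [HasFiniteLimits C] [HasFiniteColimits C] : ModelCategory C :=
  letI : CategoryWithFibrations C := ⟨.isomorphisms C⟩
  letI : CategoryWithCofibrations C := ⟨⊤⟩
  letI : CategoryWithWeakEquivalences C := ⟨⊤⟩
  have h₁ : trivialCofibrations C = ⊤ := inf_top_eq _
  have h₂ : trivialFibrations C = .isomorphisms C := inf_top_eq _
  have : (cofibrations C).IsWeakFactorizationSystem (trivialFibrations C) := by
    rw [h₂]
    exact inferInstanceAs
      ((⊤ : MorphismProperty C).IsWeakFactorizationSystem (.isomorphisms C))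
  have : (trivialCofibrations C).IsWeakFactorizationSystem (fibrations C) := by
    rw [h₁]
    exact inferInstanceAs
      ((⊤ : MorphismProperty C).IsWeakFactorizationSystem (.isomorphisms C))
  have : (weakEquivalences C).HasTwoOutOfThreeProperty :=
    inferInstanceAs ((⊤ : MorphismProperty C).HasTwoOutOfThreeProperty)
  ModelCategory.mk' C

end Contractible

end HomotopyTwoCategory

theorem mainTheorem6 :
    (∀ (C : Type u) [Category.{v} C] [ModelCategory C]
      (Φ : MorphismProperty.FunctorialFactorizationData (cofibrations C) (trivialFibrations C))
      (Ψ : MorphismProperty.FunctorialFactorizationData (trivialCofibrations C) (fibrations C)),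
      (∃ hq : (weakEquivalences C).IsInvertedBy (toHo Φ Ψ ⋙ toPiZero (Ho C)),
        ∀ (X : Type u') [Category.{v'} X],
          (precompInverting (weakEquivalences C) (toHo Φ Ψ ⋙ toPiZero (Ho C)) hq X).IsEquivalence) ∧
      ∃ e : (weakEquivalences C).Localization ≌ PiZero (Ho C),
        Nonempty ((weakEquivalences C).Q ⋙ e.functor ≅ toHo Φ Ψ ⋙ toPiZero (Ho C))) ∧
    (∃ (C : Type u) (_ : Category.{v} C) (_ : ModelCategory C),
      (cofibrations C).HasFunctorialFactorization (trivialFibrations C) ∧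
      (trivialCofibrations C).HasFunctorialFactorization (fibrations C) ∧
      ¬ ∃ (F : (weakEquivalences C).Localization ⥤ PiZero (Ho C))
          (G : PiZero (Ho C) ⥤ (weakEquivalences C).Localization),
          F ⋙ G = 𝟭 _ ∧ G ⋙ F = 𝟭 _) := by
  refine ⟨fun C _ _ Φ Ψ => ?_, WalkingArrow, inferInstance,
    contractibleModelCategory WalkingArrow, ?_, ?_, ?_⟩
  · have := toHo_toPiZero_isLocalization Φ Ψ
    exact ⟨⟨Localization.inverts _ _, fun X _ =>
        inferInstanceAs (Localization.whiskeringLeftFunctor (toHo Φ Ψ ⋙ toPiZero (Ho C))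
          (weakEquivalences C) X).IsEquivalence⟩,
      Localization.uniq _ _ (weakEquivalences C),
      ⟨Localization.compUniqFunctor _ _ (weakEquivalences C)⟩⟩
  · exact ⟨⟨(trivialFunctorialFactorizationData _).ofLE le_rfl (inf_top_eq _).ge⟩⟩
  · exact ⟨⟨(trivialFunctorialFactorizationData _).ofLE (inf_top_eq _).ge le_rfl⟩⟩
  · let _ := contractibleModelCategory WalkingArrow.{u}
    rintro ⟨F, G, hFG, -⟩
    have eq_top (X : PiZero (Ho WalkingArrow.{u})) :
        X.as.obj = ⊤_ WalkingArrow.{u} := by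
      have : IsIso (terminal.from X.as.obj) :=
        (fibration_iff _).1 X.as.property.2
      exact WalkingArrow.eq_of_isIso (terminal.from X.as.obj)
    have : Subsingleton (PiZero (Ho WalkingArrow.{u})) := by
      refine ⟨?_⟩
      rintro ⟨X⟩ ⟨Y⟩
      exact congrArg _ (ObjectProperty.FullSubcategory.ext ((eq_top ⟨X⟩).trans (eq_top ⟨Y⟩).symm))
    have inj : Function.Injective F.obj :=
      Function.LeftInverse.injective (g := G.obj) (fun X => Functor.congr_obj hFG X)
    have h : (⟨false⟩ : WalkingArrow.{u}) = ⟨true⟩ :=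
      (Localization.Construction.objEquiv (weakEquivalences WalkingArrow.{u})).injective
        (inj (Subsingleton.elim _ _))
    cases h
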